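/- Fix an integer $k\ge 0$. Let $\mathcal L$ be the set of all line segments joining consecutive integral points on lines of slope $0$, $\infty$ or $-1$ through integral points of the plane. Let $(p,q)\in\mathbb Z^2\setminus\{(0,0)\}$ and let $\gamma$ be the line segment from $(0,0)$ to $(p,q)$, deformed slightly to the left at every interior point of it that lies in $(\frac12\mathbb Z)^2$ (so that, in particular, it passes to the left of each integral point in its interior). Let $\mathcal P_{(p,q)}$ be the poset whose elements are the pairs $(\tau,i)$ with $\tau\in\mathcal L$ a segment crossed by $\gamma$ and $0\le i\le k$, and whose order is generated by the following relations: $(\tau,0)\succ(\tau,1)\succ\dots\succ(\tau,k)$ if $\gamma$ crosses $\tau$ strictly closer to the endpoint of $\tau$ to the right of $\gamma$, and $(\tau,0)\prec(\tau,1)\prec\dots\prec(\tau,k)$ otherwise; if $\gamma$ crosses $\tau$ and $\tau'$ consecutively in this order, then $(\tau,k)\succ(\tau',0)$ if the common endpoint of $\tau$ and $\tau'$ is to the right of $\gamma$, and $(\tau,k)\prec(\tau',0)$ if it is to the left. Let $m^{(k)}_{(p,q)}$ be the number of order ideals (down-closed subsets, including $\emptyset$) of $\mathcal P_{(p,q)}$,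 and put $m^{(k)}_{(0,0)}=0$. For coprime $p,q$ write $m^{(k)}_{q/p}=m^{(k)}_{(p,q)}$. Proposition. Let $p$ and $q$ be coprime integers and let $\eta=(3+3k)\,m^{(k)}_{q/p}-k$. The sequence $\big(m^{(k)}_{(np,nq)}\big)_{n\ge 0}$ satisfies $$m^{(k)}_{((n+2)p,(n+2)q)}=\big((3+3k)\,m^{(k)}_{q/p}-k\big)\,m^{(k)}_{((n+1)p,(n+1)q)}-m^{(k)}_{(np,nq)}\qquad(n\ge 0)$$ with initial conditions $m^{(k)}_{(0,0)}=0$ and $m^{(k)}_{(p,q)}=m^{(k)}_{q/p}$. Consequently, $\eta>2$ and, for all $n\ge 0$, $$m^{(k)}_{(np,nq)}=\frac{m^{(k)}_{q/p}}{\sqrt{\eta^2-4}}\left(\frac{\eta+\sqrt{\eta^2-4}}{2}\right)^n-\frac{m^{(k)}_{q/p}}{\sqrt{\eta^2-4}}\left(\frac{\eta-\sqrt{\eta^2-4}}{2}\right)^n.$$ -/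

import Mathlib

namespace KMarkov

/-- Integral points of the plane. -/
abbrev Pt : Type := ℤ × ℤ

/-- The determinant of two integral vectors; `0 < det d v` says that `v` lies strictly to the left
of the directed line through the origin with direction `d`. -/
def det (u v : Pt) : ℤ := u.1 * v.2 - u.2 * v.1

/-- `a` and `b` are the endpoints of a segment of the lattice `𝓛`, i.e. they are consecutive
integral points on a line of slope `0`, `∞` or `-1`. -/
def IsSegment (a b : Pt) : Prop :=
  b - a = (1, 0) ∨ b - a = (-1, 0) ∨ b - a = (0, 1) ∨ b - a = (0, -1) ∨
    b - a = (1, -1) ∨ b - a = (-1, 1)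

/-- For a segment with endpoints `a`, `b` on different sides of the directed line `ℝ d`, the number
`t` such that the segment meets this line in the point `t • d`. -/
def time (d a b : Pt) : ℚ := (det a b : ℚ) / ((det d b - det d a : ℤ) : ℚ)

/-- For a segment with endpoints `a`, `b` on different sides of the directed line `ℝ d`, the number
`s` such that the segment meets this line in the point `a + s • (b - a)`. -/
def fraction (d a b : Pt) : ℚ := (det d a : ℚ) / ((det d a - det d b : ℤ) : ℚ)

/-- The meaning of `time` and `fraction`: both describe the intersection point. -/
theorem meeting_point (d a b : Pt) (h : det d a ≠ det d b) :
    (a.1 : ℚ) + fraction d a b * ((b.1 : ℚ) - a.1) = time d a b * d.1 ∧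
      (a.2 : ℚ) + fraction d a b * ((b.2 : ℚ) - a.2) = time d a b * d.2 := by
  have h1 : ((det d a - det d b : ℤ) : ℚ) ≠ 0 := by
    exact_mod_cast sub_ne_zero.mpr h
  have h2 : ((det d b - det d a : ℤ) : ℚ) ≠ 0 := by
    exact_mod_cast sub_ne_zero.mpr h.symm
  unfold fraction time
  constructor
  · field_simp
    simp only [det]
    push_cast
    ring
  · field_simp
    simp only [det]
    push_cast
    ring

/-- The crossings of the curve `γ^L_d` with the segments of `𝓛`, where `γ^L_d` is the line segment
from the origin to `d`, pushed slightly to the left at all integral and half-integral points in its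
interior.

A crossing is recorded as the crossed segment, with its endpoint `left` to the left of the curve and
its endpoint `right` to the right of the curve. There are two ways in which it can arise:
* `det d right < 0`: the open line segment from the origin to `d` crosses the segment transversally;
* `det d right = 0`: `right` is an integral point in the open line segment from the origin to `d`,
  and the curve passes it on its left, so crosses the segments which leave `right` to the left. -/
structure Crossing (d : Pt) where
  left : Pt
  right : Pt
  isSegment : IsSegment left right
  left_pos : 0 < det d left
  right_nonpos : det d right ≤ 0
  time_pos : 0 < time d left right
  time_lt_one : time d left right < 1

variable {d : Pt}

/-- The curve crosses the segment at a point strictly closer to its right endpoint. (If the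
undeformed line passes through the midpoint, then the left deformation makes it closer to the left
endpoint.) -/
def Crossing.NearRight (c : Crossing d) : Prop := 1 / 2 < fraction d c.left c.right

/-- The curve meets the crossing `c` before the crossing `c'`. Two crossings with the same time
belong to the detour around a common integral point `c.right = c'.right`; this detour on the left
runs clockwise. -/
def Crossing.Before (c c' : Crossing d) : Prop :=
  time d c.left c.right < time d c'.left c'.right ∨
    (time d c.left c.right = time d c'.left c'.right ∧
      0 < det (c'.left - c'.right) (c.left - c.right))

/-- The curve crosses `c` and `c'` consecutively in this order. -/
def Crossing.Next (c c' : Crossing d) : Prop :=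
  c.Before c' ∧ ¬ ∃ e : Crossing d, c.Before e ∧ e.Before c'

/-- The elements `(τ, i)` with `τ` a crossing and `0 ≤ i ≤ k` of the fence poset. -/
abbrev FenceElem (k : ℕ) (d : Pt) : Type := Crossing d × Fin (k + 1)

/-- The generating relations `x ≺ y` of the fence poset `𝓟_d`. -/
inductive FenceStep (k : ℕ) (d : Pt) : FenceElem k d → FenceElem k d → Prop
  /-- The chain `(τ, 0) ≻ (τ, 1) ≻ ⋯ ≻ (τ, k)` at a crossing closer to the right endpoint. -/
  | chainDown (c : Crossing d) (hc : c.NearRight) (i : Fin k) :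
      FenceStep k d (c, i.succ) (c, i.castSucc)
  /-- The chain `(τ, 0) ≺ (τ, 1) ≺ ⋯ ≺ (τ, k)` at any other crossing. -/
  | chainUp (c : Crossing d) (hc : ¬ c.NearRight) (i : Fin k) :
      FenceStep k d (c, i.castSucc) (c, i.succ)
  /-- `(τ, k) ≻ (τ', 0)` if the common endpoint of `τ` and `τ'` is to the right of the curve. -/
  | linkDown (c c' : Crossing d) (hn : c.Next c') (he : c.right = c'.right) :
      FenceStep k d (c', 0) (c, Fin.last k)
  /-- `(τ, k) ≺ (τ', 0)` if the common endpoint of `τ` and `τ'` is to the left of the curve. -/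
  | linkUp (c c' : Crossing d) (hn : c.Next c') (he : c.left = c'.left) :
      FenceStep k d (c, Fin.last k) (c', 0)

/-- The order `x ≼ y` of the fence poset `𝓟_d`. -/
def FenceLe (k : ℕ) (d : Pt) : FenceElem k d → FenceElem k d → Prop :=
  Relation.ReflTransGen (FenceStep k d)

/-- The set of order ideals of the fence poset `𝓟_d`. -/
def orderIdeals (k : ℕ) (d : Pt) : Set (Set (FenceElem k d)) :=
  {I | ∀ x ∈ I, ∀ y, FenceLe k d y x → y ∈ I}

/-- The numbers `m^{(k)}_{(p,q)}` for all integral points `(p,q)`: the number of order ideals of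
`𝓟_{(p,q)}` if `(p,q)` is not the origin, and `0` for the origin. -/
noncomputable def m (k : ℕ) (p q : ℤ) : ℕ :=
  if p = 0 ∧ q = 0 then 0 else (orderIdeals k (p, q)).ncard

end KMarkov

/-! The order ideals of a fence are counted by a product of transfer matrices, one for each
relation. After a rotation of the lattice the line `ℝ d` lies in the sector `0 < x`, `0 ≤ y`. There
the segments that it crosses are numbered by `ℤ` in such a way that the translation by `d` shifts
the numbers, so the number of order ideals for `n • d` is `1ᵀ Xⁿ (1, -1)ᵀ` with the product `X` of
the transfer matrices over one period. For primitive `d ≠ (1, 0)` the central symmetry of the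
segment from `0` to `d` shows that `X = A Fᵏ Aᵀ D`, where `D` belongs to the detour around an
integral point and `F` is the elementary lower unitriangular matrix. This expresses the trace of `X`
through the number for `d`, and the theorem of Cayley and Hamilton turns it into the recurrence. -/

namespace KMarkov

open Matrix

section TransferMatrices

/-- The transfer matrix of a cover relation `y ≻ z` (for `true`) or `y ≺ z` (for `false`) of a
fence: its entries indicate which memberships of `y` (row) and `z` (column) in an order ideal are
compatible. -/
def stepMatrix : Bool → Matrix (Fin 2) (Fin 2) ℤ
  | true => !![1, 1; 0, 1]
  | false => !![1, 0; 1, 1]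

/-- The transfer matrix of a crossing, with its chain of `k` relations in the direction `near`,
followed by a relation in the direction `link`. -/
def blockMatrix (k : ℕ) (near link : Bool) : Matrix (Fin 2) (Fin 2) ℤ :=
  stepMatrix near ^ k * stepMatrix link

/-- Compatibility of the memberships `y` and `z` of two neighbouring elements of a fence in an order
ideal, where `b = true` means that the first element is the larger one. -/
def Compatible (b : Bool) (y z : Prop) : Prop := if b then (y → z) else (z → y)

theorem stepMatrix_apply (b : Bool) (y z : Fin 2) [Decidable (Compatible b (y = 1) (z = 1))] :
    stepMatrix b y z = if Compatible b (y = 1) (z = 1) then 1 else 0 := by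
  revert y z
  cases b <;> intro y z <;> fin_cases y <;> fin_cases z <;> intro h <;>
    simp [stepMatrix, Compatible]

theorem sum_prod_path_eq_vecMul {ι R : Type*} [Fintype ι] [DecidableEq ι] [CommSemiring R]
    (T : ℕ → Matrix ι ι R) (n : ℕ) (z : ι) :
    ∑ x : Fin n → ι, ∏ t : Fin n,
      T t ((Fin.snoc x z : Fin (n + 1) → ι) t.castSucc) ((Fin.snoc x z : Fin (n + 1) → ι) t.succ) =
    (1 ᵥ* ((List.range n).map T).prod) z := by
  induction n generalizing z with
  | zero => simp
  | succ n ih =>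
    rw [List.prod_range_succ, ← Matrix.vecMul_vecMul,
      ← (Fin.snocEquiv fun _ : Fin (n + 1) => ι).sum_comp, Fintype.sum_prod_type]
    refine Finset.sum_congr rfl fun y _ => ?_
    rw [← ih, Finset.sum_mul]
    refine Finset.sum_congr rfl fun x _ => ?_
    rw [Fin.prod_univ_castSucc]
    simp only [Fin.snocEquiv_apply, Fin.snoc_castSucc, Fin.succ_castSucc, Fin.succ_last,
      Fin.snoc_last, Fin.val_castSucc, Fin.val_last]

theorem ncard_compatible (w : ℕ → Bool) (n : ℕ) :
    ({x : Fin n → Fin 2 | ∀ t : Fin n,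
        Compatible (w t) ((Fin.snoc x 0 : Fin (n + 1) → Fin 2) t.castSucc = 1)
          ((Fin.snoc x 0 : Fin (n + 1) → Fin 2) t.succ = 1)}.ncard : ℤ) =
      (1 ᵥ* ((List.range n).map fun t => stepMatrix (w t)).prod) 0 := by
  classical
  rw [Set.ncard_eq_toFinset_card', Set.toFinset_ofPred, ← sum_prod_path_eq_vecMul]
  simp only [stepMatrix_apply, Finset.prod_ite_zero, Finset.prod_const_one, Finset.sum_boole,
    Finset.mem_univ, true_imp_iff]

/-- The direction of the relation between the elements number `t` and `t + 1` of a fence. -/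
def fenceWord (k : ℕ) (near link : ℕ → Bool) (t : ℕ) : Bool :=
  if t % (k + 1) = k then link (t / (k + 1)) else near (t / (k + 1))

theorem fenceWord_chain (k : ℕ) (near link : ℕ → Bool) (j : ℕ) {i : ℕ} (hi : i < k) :
    fenceWord k near link (i + (k + 1) * j) = near j := by
  rw [fenceWord, Nat.add_mul_mod_self_left, Nat.mod_eq_of_lt (by omega), if_neg hi.ne,
    Nat.add_mul_div_left _ _ k.succ_pos, Nat.div_eq_of_lt (by omega), zero_add]

theorem fenceWord_link (k : ℕ) (near link : ℕ → Bool) (j : ℕ) :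
    fenceWord k near link (k + (k + 1) * j) = link j := by
  rw [fenceWord, Nat.add_mul_mod_self_left, Nat.mod_eq_of_lt (by omega), if_pos rfl,
    Nat.add_mul_div_left _ _ k.succ_pos, Nat.div_eq_of_lt (by omega), zero_add]

theorem prod_stepMatrix_fenceWord (k : ℕ) (near link : ℕ → Bool) (N : ℕ) :
    ((List.range (N * (k + 1))).map fun t => stepMatrix (fenceWord k near link t)).prod =
      ((List.range N).map fun j => blockMatrix k (near j) (link j)).prod := by
  induction N with
  | zero => simp
  | succ N ih =>
    have hchain : (List.range k).map
        (fun i => stepMatrix (fenceWord k near link (N * (k + 1) + i))) =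
        List.replicate k (stepMatrix (near N)) := by
      rw [List.map_eq_replicate_iff.2, List.length_range]
      intro i hi
      rw [add_comm, mul_comm, fenceWord_chain k near link N (List.mem_range.1 hi)]
    have hlink : fenceWord k near link (N * (k + 1) + k) = link N := by
      rw [add_comm, mul_comm, fenceWord_link]
    rw [List.prod_range_succ, ← ih, Nat.succ_mul, List.range_add, List.map_append,
      List.prod_append, List.map_map]
    simp only [Function.comp_def]
    rw [List.prod_range_succ, hchain, List.prod_replicate, hlink, blockMatrix]

end TransferMatrices

section Counting

variable {k N : ℕ} {d : Pt} {near link : ℕ → Bool}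

theorem compatible_fenceWord_iff {y : ℕ → Prop} (hy : ¬ y (N * (k + 1)))
    (hend : ∀ j, j + 1 = N → link j = false) :
    (∀ t < N * (k + 1), Compatible (fenceWord k near link t) (y t) (y (t + 1))) ↔
      (∀ j < N, ∀ i < k, Compatible (near j) (y (i + (k + 1) * j)) (y (i + 1 + (k + 1) * j))) ∧
      ∀ j, j + 1 < N → Compatible (link j) (y (k + (k + 1) * j)) (y (0 + (k + 1) * (j + 1))) := by
  have hlt {i j : ℕ} (hi : i < k + 1) (hj : j < N) : i + (k + 1) * j < N * (k + 1) := by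
    nlinarith
  constructor
  · refine fun h => ⟨fun j hj i hi => ?_, fun j hj => ?_⟩
    · have := h _ (hlt (Nat.lt_succ_of_lt hi) hj)
      rwa [fenceWord_chain k near link j hi, add_right_comm] at this
    · have := h _ (hlt k.lt_succ_self (Nat.lt_of_succ_lt hj))
      rwa [fenceWord_link, show k + (k + 1) * j + 1 = 0 + (k + 1) * (j + 1) by ring] at this
  · rintro ⟨hchain, hlink⟩ t ht
    obtain ⟨i, j, hi, rfl⟩ : ∃ i j, i < k + 1 ∧ t = i + (k + 1) * j :=
      ⟨t % (k + 1), t / (k + 1), Nat.mod_lt t k.succ_pos, (Nat.mod_add_div t (k + 1)).symm⟩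
    have hj : j < N := by
      by_contra! hj
      nlinarith [Nat.mul_le_mul_left (k + 1) hj]
    rcases Nat.lt_succ_iff_lt_or_eq.1 hi with hi | rfl
    · rw [fenceWord_chain k near link j hi, add_right_comm]
      exact hchain j hj i hi
    · rw [fenceWord_link, show i + (i + 1) * j + 1 = 0 + (i + 1) * (j + 1) by ring]
      rcases (Nat.succ_le_of_lt hj).lt_or_eq with hj | hj
      · exact hlink j hj
      · rw [hend j hj, Compatible, if_neg Bool.false_ne_true, zero_add, ← Nat.succ_eq_add_one j, hj,
          mul_comm]
        exact fun h => (hy h).elim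

theorem mem_orderIdeals_iff (k : ℕ) (d : Pt) (I : Set (FenceElem k d)) :
    I ∈ orderIdeals k d ↔ ∀ x y, FenceStep k d x y → y ∈ I → x ∈ I := by
  constructor
  · exact fun h x y hxy hy => h y hy x (Relation.ReflTransGen.single hxy)
  · intro h y hy x hxy
    induction hxy using Relation.ReflTransGen.head_induction_on with
    | refl => exact hy
    | head hab _ ih => exact h _ _ hab ih

theorem ncard_indicator_mem {α : Type*} {n : ℕ} (e : α ≃ Fin n) (S : Set (Set α)) :
    {x : Fin n → Fin 2 | {a | x (e a) = 1} ∈ S}.ncard = S.ncard := by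
  classical
  refine Set.ncard_preimage_of_injective_subset_range (f := fun x : Fin n → Fin 2 =>
    {a | x (e a) = 1}) (fun x x' h => funext fun t => ?_)
    fun I _ => ⟨fun t => if e.symm t ∈ I then 1 else 0, by ext a; simp⟩
  have := Set.ext_iff.1 h (e.symm t)
  simp only [Set.mem_ofPred_eq, Equiv.apply_symm_apply] at this
  lia

/-- The crossings in the order of the curve are `f 0, …, f (N - 1)`, the chain at `f i` is
descending iff `near i`, and the common endpoint of `f i` and `f (i + 1)` is to the right iff
`link i`. -/
structure IsFenceCode (f : Fin N ≃ Crossing d) (near link : ℕ → Bool) : Prop where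
  before_iff : ∀ i j, (f i).Before (f j) ↔ i < j
  nearRight_iff : ∀ i, (f i).NearRight ↔ near i = true
  right_eq_iff : ∀ i j : Fin N, (i : ℕ) + 1 = j → ((f i).right = (f j).right ↔ link i = true)
  left_eq_iff : ∀ i j : Fin N, (i : ℕ) + 1 = j → ((f i).left = (f j).left ↔ link i = false)

namespace IsFenceCode

variable {f : Fin N ≃ Crossing d}

theorem next_iff (hf : IsFenceCode f near link) (i j : Fin N) :
    (f i).Next (f j) ↔ (i : ℕ) + 1 = j := by
  rw [Crossing.Next, hf.before_iff, ← f.exists_congr_right]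
  simp only [hf.before_iff, Fin.lt_def]
  constructor
  · rintro ⟨hij, h⟩
    by_contra hne
    exact h ⟨⟨i + 1, by omega⟩, by grind⟩
  · refine fun h => ⟨by omega, ?_⟩
    rintro ⟨l, hil, hlj⟩
    omega

theorem mem_orderIdeals_iff_compatible (hf : IsFenceCode f near link) (I : Set (FenceElem k d)) :
    I ∈ orderIdeals k d ↔
      (∀ (j : Fin N) (i : Fin k),
        Compatible (near j) ((f j, i.castSucc) ∈ I) ((f j, i.succ) ∈ I)) ∧
      ∀ i j : Fin N, (i : ℕ) + 1 = j →
        Compatible (link i) ((f i, Fin.last k) ∈ I) ((f j, 0) ∈ I) := by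
  rw [mem_orderIdeals_iff]
  constructor
  · refine fun h => ⟨fun j i => ?_, fun i j hij => ?_⟩
    · cases hb : near j
      · exact h _ _ (.chainUp _ (by simp [hf.nearRight_iff, hb]) i)
      · exact h _ _ (.chainDown _ ((hf.nearRight_iff j).2 hb) i)
    · cases hb : link i
      · exact h _ _ (.linkUp _ _ ((hf.next_iff i j).2 hij) ((hf.left_eq_iff i j hij).2 hb))
      · exact h _ _ (.linkDown _ _ ((hf.next_iff i j).2 hij) ((hf.right_eq_iff i j hij).2 hb))
  · rintro ⟨hchain, hlink⟩ x y hxy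
    cases hxy with
    | chainDown c hc i =>
      obtain ⟨j, rfl⟩ := f.surjective c
      simpa [Compatible, (hf.nearRight_iff j).1 hc] using hchain j i
    | chainUp c hc i =>
      obtain ⟨j, rfl⟩ := f.surjective c
      rw [hf.nearRight_iff, Bool.not_eq_true] at hc
      simpa [Compatible, hc] using hchain j i
    | linkDown c c' hn he =>
      obtain ⟨⟨i, rfl⟩, ⟨j, rfl⟩⟩ := f.surjective c, f.surjective c'
      have hij := (hf.next_iff i j).1 hn
      simpa [Compatible, (hf.right_eq_iff i j hij).1 he] using hlink i j hij
    | linkUp c c' hn he =>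
      obtain ⟨⟨i, rfl⟩, ⟨j, rfl⟩⟩ := f.surjective c, f.surjective c'
      have hij := (hf.next_iff i j).1 hn
      simpa [Compatible, (hf.left_eq_iff i j hij).1 he] using hlink i j hij

theorem ncard_orderIdeals (hf : IsFenceCode f near link)
    (hend : ∀ j, j + 1 = N → link j = false) :
    ((orderIdeals k d).ncard : ℤ) =
      (1 ᵥ* ((List.range N).map fun j => blockMatrix k (near j) (link j)).prod) 0 := by
  let e : FenceElem k d ≃ Fin (N * (k + 1)) :=
    (f.symm.prodCongr (Equiv.refl _)).trans finProdFinEquiv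
  rw [← prod_stepMatrix_fenceWord, ← ncard_compatible, ← ncard_indicator_mem e]
  congr 2
  ext x
  let y (t : ℕ) : Prop := ∃ h : t < N * (k + 1), x ⟨t, h⟩ = 1
  have hsnoc (t : Fin (N * (k + 1) + 1)) :
      (Fin.snoc x 0 : Fin (N * (k + 1) + 1) → Fin 2) t = 1 ↔ y t := by
    refine Fin.lastCases ?_ (fun t => ?_) t <;> simp [y]
  have hideal (j : Fin N) (i : Fin (k + 1)) : x (e (f j, i)) = 1 ↔ y (i + (k + 1) * j) := by
    have he : e (f j, i) = finProdFinEquiv (j, i) := by simp [e]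
    have hval : i + (k + 1) * (j : ℕ) < N * (k + 1) := (finProdFinEquiv (j, i)).2
    rw [he]
    exact ⟨fun h => ⟨hval, h⟩, fun ⟨_, h⟩ => h⟩
  have hy : ¬ y (N * (k + 1)) := fun ⟨h, _⟩ => h.false
  have hword := compatible_fenceWord_iff (near := near) hy hend
  simp only [Set.mem_ofPred_eq, hf.mem_orderIdeals_iff_compatible, hideal, hsnoc]
  refine Iff.trans (and_congr (by simp [Fin.forall_iff]) ?_) (hword.symm.trans ?_)
  · exact ⟨fun h j hj => h ⟨j, by omega⟩ ⟨j + 1, hj⟩ rfl, fun h i j hij => by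
      rw [← hij]; exact h i (hij ▸ j.2)⟩
  · simp [Fin.forall_iff]

end IsFenceCode

end Counting

section OrderedProd

/-- The product `T a * T (a + 1) * ⋯ * T (a + n - 1)` in this order. -/
def orderedProd {M : Type*} [Monoid M] (T : ℤ → M) (a : ℤ) (n : ℕ) : M :=
  ((List.range n).map fun i : ℕ => T (a + i)).prod

variable {M : Type*} [Monoid M] {T T' : ℤ → M} {a b : ℤ} {n : ℕ}

theorem orderedProd_zero : orderedProd T a 0 = 1 := rfl

theorem orderedProd_succ : orderedProd T a (n + 1) = orderedProd T a n * T (a + n) :=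
  List.prod_range_succ _ _

theorem orderedProd_succ' : orderedProd T a (n + 1) = T a * orderedProd T (a + 1) n := by
  simp only [orderedProd, List.prod_range_succ', Nat.cast_zero, add_zero, Nat.cast_succ, add_assoc,
    add_comm (1 : ℤ)]

theorem orderedProd_add (T : ℤ → M) (a : ℤ) (n n' : ℕ) :
    orderedProd T a (n + n') = orderedProd T a n * orderedProd T (a + n) n' := by
  simp only [orderedProd, List.range_add, List.map_append, List.map_map, List.prod_append,
    Function.comp_def, Nat.cast_add, add_assoc]

theorem orderedProd_congr (h : ∀ i : ℕ, i < n → T (a + i) = T' (b + i)) :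
    orderedProd T a n = orderedProd T' b n :=
  congrArg List.prod (List.map_congr_left fun i hi => h i (List.mem_range.1 hi))

theorem orderedProd_mul_of_periodic {p : ℕ} (hT : Function.Periodic T (p : ℤ)) :
    orderedProd T a (n * p) = orderedProd T a p ^ n := by
  induction n with
  | zero => rw [zero_mul, orderedProd_zero, pow_zero]
  | succ n ih =>
    rw [Nat.succ_mul, orderedProd_add, ih, pow_succ]
    congr 1
    refine orderedProd_congr fun i _ => ?_
    rw [Nat.cast_mul, add_right_comm]
    exact hT.nat_mul n _

variable {ι R : Type*} [Fintype ι] [DecidableEq ι] [CommRing R]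

theorem det_orderedProd {T : ℤ → Matrix ι ι R} (hT : ∀ j, (T j).det = 1) (a : ℤ) (n : ℕ) :
    (orderedProd T a n).det = 1 := by
  induction n with
  | zero => rw [orderedProd_zero, det_one]
  | succ n ih => rw [orderedProd_succ, det_mul, ih, hT, one_mul]

theorem orderedProd_mul_eq_of_reflection (C L : ℤ → Matrix ι ι R) (c : ℤ) (n : ℕ)
    (hC : ∀ i : ℕ, i < n → C (c + 1 + i) = (C (c - 1 - i))ᵀ)
    (hL : ∀ i : ℕ, i < n → L (c + i) = (L (c - 1 - i))ᵀ) :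
    orderedProd (C * L) c (n + 1) = C c * (orderedProd (C * L) (c - n) n)ᵀ * L (c + n) := by
  induction n with
  | zero => simp [orderedProd]
  | succ n ih =>
    rw [orderedProd_succ, ih (fun i hi => hC i (by omega)) fun i hi => hL i (by omega),
      orderedProd_succ']
    have ha : c - (n + 1 : ℕ) = c - 1 - n := by push_cast; ring
    have hb : c + (n + 1 : ℕ) = c + 1 + n := by push_cast; ring
    rw [ha, hb, Pi.mul_apply, Pi.mul_apply, transpose_mul, transpose_mul, ← hL n n.lt_succ_self,
      ← hC n n.lt_succ_self, show c - 1 - n + 1 = c - n by ring]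
    simp only [mul_assoc]

end OrderedProd

section Algebra

theorem transpose_stepMatrix (b : Bool) : (stepMatrix b)ᵀ = stepMatrix (!b) := by
  cases b <;> simp [stepMatrix, ← Matrix.ext_iff, Fin.forall_fin_two]

theorem det_stepMatrix (b : Bool) : (stepMatrix b).det = 1 := by
  cases b <;> simp [stepMatrix]

theorem det_blockMatrix (k : ℕ) (near link : Bool) : (blockMatrix k near link).det = 1 := by
  rw [blockMatrix, det_mul, det_pow, det_stepMatrix, det_stepMatrix, one_pow, one_mul]

theorem stepMatrix_true_pow (n : ℕ) : stepMatrix true ^ n = !![1, (n : ℤ); 0, 1] := by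
  induction n with
  | zero => simp [one_fin_two]
  | succ n ih => rw [pow_succ, ih]; simp [stepMatrix, add_comm]

theorem stepMatrix_false_pow (n : ℕ) : stepMatrix false ^ n = !![1, 0; (n : ℤ), 1] := by
  induction n with
  | zero => simp [one_fin_two]
  | succ n ih => rw [pow_succ, ih]; simp [stepMatrix]

theorem mul_stepMatrix_pow_mul_transpose_sub (k : ℕ) {A : Matrix (Fin 2) (Fin 2) ℤ}
    (hA : A.det = 1) :
    (A * stepMatrix false ^ k * Aᵀ) 1 0 - (A * stepMatrix false ^ k * Aᵀ) 0 1 = k := by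
  rw [det_fin_two] at hA
  rw [stepMatrix_false_pow]
  simp only [mul_apply, transpose_apply, Fin.sum_univ_two, of_apply, cons_val]
  linear_combination (k : ℤ) * hA

/-- The product of the transfer matrices of the detour around an interior integral point, beginning
with the relation that leads to the detour and ending with the relation that leaves it. -/
def detourMatrix (k : ℕ) : Matrix (Fin 2) (Fin 2) ℤ :=
  stepMatrix false * stepMatrix true ^ (3 * k + 2) * stepMatrix false

theorem detourMatrix_eq (k : ℕ) :
    detourMatrix k = !![3 * (k : ℤ) + 3, 3 * k + 2; 3 * k + 4, 3 * k + 3] := by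
  rw [detourMatrix, stepMatrix_true_pow]
  simp only [stepMatrix, mul_fin_two]
  push_cast
  ring_nf

theorem trace_mul_detourMatrix (k : ℕ) {M : Matrix (Fin 2) (Fin 2) ℤ} (hM : M 1 0 - M 0 1 = k) :
    (M * detourMatrix k).trace = (3 + 3 * k) * (1 ⬝ᵥ (M * detourMatrix k) *ᵥ ![1, -1]) - k := by
  have hv : detourMatrix k *ᵥ ![1, -1] = 1 := by
    rw [detourMatrix_eq]
    ext i
    fin_cases i <;>
      simp only [mulVec, dotProduct, Fin.sum_univ_two, of_apply, cons_val, Pi.one_apply,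
        Fin.zero_eta, Fin.mk_one] <;>
      ring
  rw [← mulVec_mulVec, hv, detourMatrix_eq, trace_fin_two]
  simp only [mul_apply, dotProduct, mulVec, Fin.sum_univ_two, of_apply, cons_val, Pi.one_apply]
  linear_combination -hM

theorem dotProduct_pow_add_two_mulVec {R : Type*} [CommRing R] {X : Matrix (Fin 2) (Fin 2) R}
    (hX : X.det = 1) (u v : Fin 2 → R) (n : ℕ) :
    u ⬝ᵥ X ^ (n + 2) *ᵥ v =
      X.trace * (u ⬝ᵥ X ^ (n + 1) *ᵥ v) - u ⬝ᵥ X ^ n *ᵥ v := by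
  have hch : X ^ 2 = X.trace • X - 1 := by
    nontriviality R
    have := X.aeval_self_charpoly
    rw [charpoly_fin_two, hX] at this
    simp only [map_add, map_sub, map_mul, map_pow, Polynomial.aeval_X, Polynomial.aeval_C, map_one,
      ← Algebra.smul_def] at this
    rwa [sub_add, sub_eq_zero] at this
  rw [pow_add, hch, mul_sub, mul_one, mul_smul_comm, ← pow_succ, sub_mulVec, smul_mulVec,
    dotProduct_sub, dotProduct_smul, smul_eq_mul]

theorem closed_form (u : ℕ → ℝ) (η : ℝ) (hη : 2 < η) (h0 : u 0 = 0)
    (h : ∀ n, u (n + 2) = η * u (n + 1) - u n) (n : ℕ) :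
    u n = u 1 / √(η ^ 2 - 4) * ((η + √(η ^ 2 - 4)) / 2) ^ n -
      u 1 / √(η ^ 2 - 4) * ((η - √(η ^ 2 - 4)) / 2) ^ n := by
  have hpos : 0 < η ^ 2 - 4 := by nlinarith
  have hs : √(η ^ 2 - 4) ^ 2 = η ^ 2 - 4 := Real.sq_sqrt hpos.le
  have hs0 : √(η ^ 2 - 4) ≠ 0 := (Real.sqrt_pos.mpr hpos).ne'
  generalize √(η ^ 2 - 4) = s at hs hs0 ⊢
  have hroot (t : ℝ) (ht : t ^ 2 = η ^ 2 - 4) (n : ℕ) :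
      ((η + t) / 2) ^ (n + 2) = η * ((η + t) / 2) ^ (n + 1) - ((η + t) / 2) ^ n := by
    linear_combination ((η + t) / 2) ^ n * ht / 4
  induction n using Nat.twoStepInduction with
  | zero => simp [h0]
  | one => field_simp; ring
  | more n ih1 ih2 =>
    rw [h, ih2, ih1, hroot s hs, sub_eq_add_neg η s, hroot (-s) (by rw [neg_sq, hs])]
    ring

end Algebra

section LineCrossings

theorem det_add (u v w : Pt) : det u (v + w) = det u v + det u w := by
  simp only [det, Prod.fst_add, Prod.snd_add]; ring

theorem det_sub (u v w : Pt) : det u (v - w) = det u v - det u w := by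
  simp only [det, Prod.fst_sub, Prod.snd_sub]; ring

theorem det_self (u : Pt) : det u u = 0 := by
  simp only [det]; ring

/-- The segment with endpoints `c.1` and `c.2` crosses, from left to right, the whole directed line
`ℝ e`, pushed slightly to the left at all integral points. -/
structure LineCrosses (e : Pt) (c : Pt × Pt) : Prop where
  isSegment : IsSegment c.1 c.2
  left_pos : 0 < det e c.1
  right_nonpos : det e c.2 ≤ 0

/-- The sum of the coordinates of the two endpoints of a segment, which numbers the crossings of
a line in the first sector. -/
def level (c : Pt × Pt) : ℤ := c.1.1 + c.1.2 + c.2.1 + c.2.2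

/-- The first level at which the right endpoint is `b`, for an integral point `b` of the line. -/
def detourStart (e b : Pt) : ℤ := 2 * (b.1 + b.2) - if 0 < e.2 then 1 else 0

variable {e : Pt}

section Sector

variable (hP : 0 < e.1) (hQ : 0 ≤ e.2)
include hP hQ

theorem fst_lt_or_snd_lt {x y : Pt} (hx : 0 < det e x) (hy : det e y ≤ 0) :
    x.1 < y.1 ∨ y.2 < x.2 := by
  by_contra! h
  unfold det at hx hy
  nlinarith [mul_le_mul_of_nonneg_left h.1 hQ, mul_le_mul_of_nonneg_left h.2 hP.le]

theorem exists_lineCrosses_level_eq_two_mul (s : ℤ) : ∃ c, LineCrosses e c ∧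
    level c = 2 * s ∧ c.2 = c.1 + (1, -1) := by
  have hl : 0 < e.1 + e.2 := by omega
  have hle := Int.mul_ediv_self_le (x := e.1 * s - 1) hl.ne'
  have hlt := Int.lt_ediv_add_one_mul_self (e.1 * s - 1) hl
  set x := (e.1 * s - 1) / (e.1 + e.2)
  refine ⟨((x, s - x), (x, s - x) + (1, -1)), ⟨?_, ?_, ?_⟩, ?_, rfl⟩
  · simp [IsSegment]
  · simp only [det]; linarith
  · simp only [det, Prod.mk_add_mk]; linarith
  · simp only [level, Prod.mk_add_mk]; ring

theorem exists_lineCrosses_level_eq (j : ℤ) : ∃ c, LineCrosses e c ∧ level c = j := by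
  obtain ⟨s, rfl | rfl⟩ := j.even_or_odd'
  · obtain ⟨c, hc, hlevel, -⟩ := exists_lineCrosses_level_eq_two_mul hP hQ s
    exact ⟨c, hc, hlevel⟩
  · obtain ⟨⟨a, b⟩, hc, hlevel, rfl : b = a + (1, -1)⟩ :=
      exists_lineCrosses_level_eq_two_mul hP hQ s
    simp only [level, Prod.fst_add, Prod.snd_add] at hlevel
    rcases lt_or_ge 0 (det e (a + (1, 0))) with hapex | hapex
    · refine ⟨(a + (1, 0), a + (1, -1)), ⟨by simp [IsSegment], hapex, hc.right_nonpos⟩, ?_⟩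
      simp only [level, Prod.fst_add, Prod.snd_add]
      linarith
    · refine ⟨(a, a + (1, 0)), ⟨by simp [IsSegment], hc.left_pos, hapex⟩, ?_⟩
      simp only [level, Prod.fst_add, Prod.snd_add]
      linarith

namespace LineCrosses

variable {c c' : Pt × Pt}

theorem direction (hc : LineCrosses e c) :
    (c.2.1 = c.1.1 + 1 ∧ c.2.2 = c.1.2) ∨ (c.2.1 = c.1.1 ∧ c.2.2 = c.1.2 - 1) ∨
      (c.2.1 = c.1.1 + 1 ∧ c.2.2 = c.1.2 - 1) := by
  have hseg := hc.isSegment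
  have hlt := fst_lt_or_snd_lt hP hQ hc.left_pos hc.right_nonpos
  simp only [IsSegment, Prod.ext_iff, Prod.fst_sub, Prod.snd_sub] at hseg
  omega

theorem eq_of_level_eq (hc : LineCrosses e c) (hc' : LineCrosses e c')
    (h : level c = level c') : c = c' := by
  have hdir := hc.direction hP hQ
  have hdir' := hc'.direction hP hQ
  have hlt := fst_lt_or_snd_lt hP hQ hc.left_pos hc'.right_nonpos
  have hlt' := fst_lt_or_snd_lt hP hQ hc'.left_pos hc.right_nonpos
  simp only [level, Prod.ext_iff] at h ⊢
  omega

theorem left_eq_iff_right_ne (hc : LineCrosses e c) (hc' : LineCrosses e c')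
    (h : level c' = level c + 1) : c.1 = c'.1 ↔ c.2 ≠ c'.2 := by
  have hdir := hc.direction hP hQ
  have hdir' := hc'.direction hP hQ
  have hlt := fst_lt_or_snd_lt hP hQ hc.left_pos hc'.right_nonpos
  have hlt' := fst_lt_or_snd_lt hP hQ hc'.left_pos hc.right_nonpos
  simp only [level, Prod.ext_iff, ne_eq] at h ⊢
  omega

theorem right_eq_iff {b : Pt} (hb : det e b = 0) (hc : LineCrosses e c) :
    c.2 = b ↔ detourStart e b ≤ level c ∧ level c ≤ 2 * (b.1 + b.2) + 1 := by
  have hstar {v : Pt} (hv : IsSegment v 0) (hv' : 0 < det e v)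
      (h : level c = 2 * (b.1 + b.2) + v.1 + v.2) : c.2 = b := by
    have hc' : LineCrosses e (v + b, b) :=
      ⟨by simpa [IsSegment] using hv, by simpa only [det_add, hb, add_zero], hb.le⟩
    refine congrArg Prod.snd (hc.eq_of_level_eq hP hQ hc' (h.trans ?_))
    simp only [level, Prod.fst_add, Prod.snd_add]
    ring
  constructor
  · rintro rfl
    have hhoriz (h : c.1.2 = c.2.2) : c.1.1 < c.2.1 → 0 < e.2 := by
      have hleft := hc.left_pos
      unfold det at hb hleft
      rw [h] at hleft
      intro hlt
      nlinarith
    have hdir := hc.direction hP hQ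
    unfold detourStart level
    split_ifs <;> omega
  · rintro ⟨hge, hle⟩
    unfold detourStart at hge
    obtain ⟨hQ, h⟩ | h | h : (0 < e.2 ∧ level c = 2 * (b.1 + b.2) + -1 + 0) ∨
        level c = 2 * (b.1 + b.2) + -1 + 1 ∨ level c = 2 * (b.1 + b.2) + 0 + 1 := by
      split_ifs at hge <;> omega
    · exact hstar (v := (-1, 0)) (by simp [IsSegment]) (by simpa [det]) h
    · exact hstar (v := (-1, 1)) (by simp [IsSegment]) (by simp only [det]; omega) h
    · exact hstar (v := (0, 1)) (by simp [IsSegment]) (by simpa [det]) h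

end LineCrosses

end Sector

end LineCrossings

section Times

variable {e : Pt} {c c' : Pt × Pt}

namespace LineCrosses

theorem det_sub_pos (hc : LineCrosses e c) : (0 : ℚ) < (det e c.1 - det e c.2 : ℤ) := by
  have := hc.left_pos
  have := hc.right_nonpos
  exact_mod_cast (by omega : 0 < det e c.1 - det e c.2)

theorem fraction_pos (hc : LineCrosses e c) : 0 < fraction e c.1 c.2 :=
  div_pos (by exact_mod_cast hc.left_pos) hc.det_sub_pos

theorem fraction_le_one (hc : LineCrosses e c) : fraction e c.1 c.2 ≤ 1 := by
  rw [fraction, div_le_one hc.det_sub_pos]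
  exact_mod_cast (by linarith [hc.right_nonpos] : det e c.1 ≤ det e c.1 - det e c.2)

theorem fraction_eq_one_iff (hc : LineCrosses e c) :
    fraction e c.1 c.2 = 1 ↔ det e c.2 = 0 := by
  rw [fraction, div_eq_one_iff_eq hc.det_sub_pos.ne', Int.cast_inj]
  omega

theorem half_lt_fraction_iff (hc : LineCrosses e c) :
    1 / 2 < fraction e c.1 c.2 ↔ 0 < det e (c.1 + c.2) := by
  rw [fraction, lt_div_iff₀ hc.det_sub_pos, det_add, ← Int.cast_pos (R := ℚ)]
  push_cast
  constructor <;> intro h <;> linarith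

theorem mul_time_eq (hc : LineCrosses e c) (hb : det e c.2 = 0) :
    (e.1 + e.2 : ℤ) * time e c.1 c.2 = (c.2.1 + c.2.2 : ℤ) := by
  obtain ⟨hx, hy⟩ := meeting_point e c.1 c.2 (hc.right_nonpos.trans_lt hc.left_pos).ne'
  rw [hc.fraction_eq_one_iff.2 hb] at hx hy
  push_cast
  linear_combination -hx - hy

end LineCrosses

variable (hP : 0 < e.1) (hQ : 0 ≤ e.2)
include hP hQ

namespace LineCrosses

-- The sum of the coordinates of the point `t • e` of the line is `(e.1 + e.2) * t`.
theorem exists_mul_time_eq (hc : LineCrosses e c) : ∃ s : ℤ,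
    level c = 2 * s ∧ (e.1 + e.2 : ℤ) * time e c.1 c.2 = s ∨
    level c = 2 * s + 1 ∧ ((e.1 + e.2 : ℤ) * time e c.1 c.2 = s + fraction e c.1 c.2 ∨
      (e.1 + e.2 : ℤ) * time e c.1 c.2 = s + 1 - fraction e c.1 c.2) := by
  obtain ⟨hx, hy⟩ := meeting_point e c.1 c.2 (hc.right_nonpos.trans_lt hc.left_pos).ne'
  simp only [level]
  obtain ⟨h1, h2⟩ | ⟨h1, h2⟩ | ⟨h1, h2⟩ := hc.direction hP hQ <;> rw [h1] at hx ⊢ <;>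
    rw [h2] at hy ⊢ <;> push_cast at hx hy ⊢
  · exact ⟨c.1.1 + c.1.2, .inr ⟨by ring, .inl (by push_cast; linear_combination -hx - hy)⟩⟩
  · exact ⟨c.1.1 + c.1.2 - 1, .inr ⟨by ring, .inr (by push_cast; linear_combination -hx - hy)⟩⟩
  · exact ⟨c.1.1 + c.1.2, .inl ⟨by ring, by push_cast; linear_combination -hx - hy⟩⟩

theorem level_ediv_two_le (hc : LineCrosses e c) :
    (level c / 2 : ℤ) ≤ (e.1 + e.2 : ℤ) * time e c.1 c.2 := by
  have hpos := hc.fraction_pos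
  have hle := hc.fraction_le_one
  obtain ⟨s, ⟨hlevel, ht⟩ | ⟨hlevel, ht | ht⟩⟩ := hc.exists_mul_time_eq hP hQ <;>
    rw [ht, (by omega : level c / 2 = s)] <;> linarith

theorem mul_time_le (hc : LineCrosses e c) :
    (e.1 + e.2 : ℤ) * time e c.1 c.2 ≤ ((level c + 1) / 2 : ℤ) := by
  have hpos := hc.fraction_pos
  have hle := hc.fraction_le_one
  obtain ⟨s, ⟨hlevel, ht⟩ | ⟨hlevel, ht⟩⟩ := hc.exists_mul_time_eq hP hQ
  · rw [ht, (by omega : (level c + 1) / 2 = s)]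
  · rcases ht with ht | ht <;>
      rw [ht, (by omega : (level c + 1) / 2 = s + 1), Int.cast_add, Int.cast_one] <;> linarith

theorem det_right_eq_zero (hc : LineCrosses e c) (hodd : Odd (level c)) {s : ℤ}
    (ht : (e.1 + e.2 : ℤ) * time e c.1 c.2 = s) : det e c.2 = 0 := by
  rw [← hc.fraction_eq_one_iff]
  have hpos := hc.fraction_pos
  have hle := hc.fraction_le_one
  have hint {f : ℚ} (n : ℤ) (hf : 0 < f) (hf' : f ≤ 1) (h : f = n) : f = 1 := by
    rw [h] at hf hf' ⊢
    norm_cast at *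
    omega
  obtain ⟨s', ⟨hlevel, -⟩ | ⟨-, ht' | ht'⟩⟩ := hc.exists_mul_time_eq hP hQ
  · rw [Int.odd_iff] at hodd
    omega
  · exact hint (s - s') hpos hle (by push_cast; linarith)
  · exact hint (s' + 1 - s) hpos hle (by push_cast; linarith)

theorem time_lt_time (hc : LineCrosses e c) (hc' : LineCrosses e c') (hlt : level c < level c')
    (hne : c.2 = c'.2 → det e c.2 ≠ 0) : time e c.1 c.2 < time e c'.1 c'.2 := by
  have hl : (0 : ℚ) < (e.1 + e.2 : ℤ) := by exact_mod_cast (by omega : 0 < e.1 + e.2)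
  by_contra! hle
  replace hle := mul_le_mul_of_nonneg_left hle hl.le
  have hceil := hc.mul_time_le hP hQ
  have hfloor := hc'.level_ediv_two_le hP hQ
  have hs : (level c + 1) / 2 = level c' / 2 := by
    have : level c' / 2 ≤ (level c + 1) / 2 := by exact_mod_cast hfloor.trans (hle.trans hceil)
    omega
  rw [← hs] at hfloor
  have ht := hceil.antisymm (hfloor.trans hle)
  have ht' := hfloor.antisymm (hle.trans hceil)
  rcases Int.even_or_odd (level c) with hparity | hparity
  · have hb := hc'.det_right_eq_zero hP hQ (by rw [Int.odd_iff]; grind) ht'.symm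
    have hsum := (hc'.mul_time_eq hb).symm.trans ht'.symm
    have hright : c.2 = c'.2 := by
      refine (hc.right_eq_iff hP hQ hb).2 ⟨?_, ?_⟩
      · norm_cast at hsum
        unfold detourStart
        grind
      · exact hlt.le.trans ((hc'.right_eq_iff hP hQ hb).1 rfl).2
    exact hne hright (hright ▸ hb)
  · have hb := hc.det_right_eq_zero hP hQ hparity ht
    have hsum := (hc.mul_time_eq hb).symm.trans ht
    refine hne (Eq.symm ((hc'.right_eq_iff hP hQ hb).2 ⟨?_, ?_⟩)) hb
    · exact ((hc.right_eq_iff hP hQ hb).1 rfl).1.trans hlt.le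
    · norm_cast at hsum
      omega

theorem det_sub_pos_of_right_eq (hc : LineCrosses e c) (hc' : LineCrosses e c')
    (hlt : level c < level c') (hright : c.2 = c'.2) :
    0 < det (c'.1 - c'.2) (c.1 - c.2) := by
  have hdir := hc.direction hP hQ
  have hdir' := hc'.direction hP hQ
  have hx := congrArg Prod.fst hright
  have hy := congrArg Prod.snd hright
  simp only [level] at hlt
  simp only [det, Prod.fst_sub, Prod.snd_sub]
  obtain ⟨h1, h2⟩ | ⟨h1, h2⟩ | ⟨h1, h2⟩ := hdir <;>
  obtain ⟨h1', h2'⟩ | ⟨h1', h2'⟩ | ⟨h1', h2'⟩ := hdir' <;>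
  first
  | omega
  | simp [h1, h2, h1', h2']

variable {b : Pt}

theorem mul_time_trichotomy (hb : det e b = 0) (hc : LineCrosses e c) :
    level c < detourStart e b ∧ (e.1 + e.2 : ℤ) * time e c.1 c.2 < (b.1 + b.2 : ℤ) ∨
    (detourStart e b ≤ level c ∧ level c ≤ 2 * (b.1 + b.2) + 1) ∧
      (e.1 + e.2 : ℤ) * time e c.1 c.2 = (b.1 + b.2 : ℤ) ∨
    2 * (b.1 + b.2) + 1 < level c ∧ (b.1 + b.2 : ℤ) < (e.1 + e.2 : ℤ) * time e c.1 c.2 := by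
  have hl : (0 : ℚ) < (e.1 + e.2 : ℤ) := by exact_mod_cast (by omega : 0 < e.1 + e.2)
  have hc' : LineCrosses e (b + (0, 1), b) :=
    ⟨by simp [IsSegment], by rw [det_add, hb]; simpa [det], hb.le⟩
  have ht : _ = ((b.1 + b.2 : ℤ) : ℚ) := hc'.mul_time_eq hb
  have hlevel : level (b + (0, 1), b) = 2 * (b.1 + b.2) + 1 := by
    simp only [level, Prod.fst_add, Prod.snd_add]
    ring
  rw [← ht, mul_lt_mul_iff_right₀ hl, mul_lt_mul_iff_right₀ hl]
  have hright := hc.right_eq_iff hP hQ hb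
  by_cases hcb : c.2 = b
  · subst hcb
    exact .inr (.inl ⟨hright.1 rfl, ht ▸ hc.mul_time_eq hb⟩)
  rcases lt_or_ge (level (b + (0, 1), b)) (level c) with hlt | hle
  · exact .inr (.inr ⟨hlevel ▸ hlt, hc'.time_lt_time hP hQ hc hlt fun h => absurd h.symm hcb⟩)
  · have hstart : level c < detourStart e b := by
      by_contra! hge
      exact hcb (hright.2 ⟨hge, hlevel ▸ hle⟩)
    refine .inl ⟨hstart, hc.time_lt_time hP hQ hc' ?_ fun h => absurd h hcb⟩
    exact hstart.trans_le ((hc'.right_eq_iff hP hQ hb).1 rfl).1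

theorem time_pos_iff (hc : LineCrosses e c) : 0 < time e c.1 c.2 ↔ 2 ≤ level c := by
  have hl : (0 : ℚ) < (e.1 + e.2 : ℤ) := by exact_mod_cast (by omega : 0 < e.1 + e.2)
  have h := hc.mul_time_trichotomy hP hQ (b := 0) (by simp [det])
  simp only [Prod.fst_zero, Prod.snd_zero, add_zero, Int.cast_zero] at h
  rw [← mul_pos_iff_of_pos_left hl]
  rcases h with ⟨h, ht⟩ | ⟨⟨-, h⟩, ht⟩ | ⟨h, ht⟩
  · have : detourStart e 0 ≤ 0 := by unfold detourStart; split_ifs <;> simp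
    exact iff_of_false ht.not_gt (by omega)
  · exact iff_of_false ht.not_gt (by omega)
  · exact iff_of_true ht (by omega)

theorem time_lt_one_iff (hc : LineCrosses e c) :
    time e c.1 c.2 < 1 ↔ level c < detourStart e e := by
  have hl : (0 : ℚ) < (e.1 + e.2 : ℤ) := by exact_mod_cast (by omega : 0 < e.1 + e.2)
  have h := hc.mul_time_trichotomy hP hQ (det_self e)
  rw [← mul_lt_iff_lt_one_right hl]
  rcases h with ⟨h, ht⟩ | ⟨⟨h, -⟩, ht⟩ | ⟨h, ht⟩
  · exact iff_of_true ht h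
  · exact iff_of_false ht.not_lt h.not_gt
  · have : detourStart e e ≤ 2 * (e.1 + e.2) := by unfold detourStart; split_ifs <;> simp
    exact iff_of_false ht.not_gt (by omega)

end LineCrosses

end Times

section Cross

/-- The crossing of the line `ℝ e` with the given level. It exists and is unique for `e` in the
first sector. -/
noncomputable def cross (e : Pt) (j : ℤ) : Pt × Pt :=
  Classical.epsilon fun c => LineCrosses e c ∧ level c = j

/-- Whether the line `ℝ e` crosses `cross e j` closer to its right endpoint. -/
noncomputable def crossNear (e : Pt) (j : ℤ) : Bool :=
  decide (0 < det e ((cross e j).1 + (cross e j).2))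

/-- Whether the common endpoint of `cross e j` and `cross e (j + 1)` is to the right of the line. -/
noncomputable def crossLink (e : Pt) (j : ℤ) : Bool :=
  decide ((cross e j).2 = (cross e (j + 1)).2)

variable {e b : Pt} {c : Pt × Pt} {j : ℤ}

theorem det_nsmul_left (n : ℕ) (u v : Pt) : det (n • u) v = n * det u v := by
  rw [← natCast_zsmul]
  simp only [det, Prod.smul_fst, Prod.smul_snd, smul_eq_mul]
  ring

theorem lineCrosses_nsmul_iff {n : ℕ} (hn : 0 < n) : LineCrosses (n • e) c ↔ LineCrosses e c := by
  have hn' : (0 : ℤ) < n := by exact_mod_cast hn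
  constructor <;> rintro ⟨hseg, hleft, hright⟩
  · rw [det_nsmul_left] at hleft hright
    exact ⟨hseg, pos_of_mul_pos_right hleft hn'.le, nonpos_of_mul_nonpos_right hright hn'⟩
  · refine ⟨hseg, ?_, ?_⟩ <;> rw [det_nsmul_left]
    · exact mul_pos hn' hleft
    · exact mul_nonpos_of_nonneg_of_nonpos hn'.le hright

theorem cross_nsmul {n : ℕ} (hn : 0 < n) (e : Pt) : cross (n • e) = cross e := by
  funext j
  simp only [cross, lineCrosses_nsmul_iff hn]

theorem crossNear_nsmul {n : ℕ} (hn : 0 < n) (e : Pt) : crossNear (n • e) = crossNear e := by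
  funext j
  have hn' : (0 : ℤ) < n := by exact_mod_cast hn
  simp only [crossNear, cross_nsmul hn, det_nsmul_left, mul_pos_iff_of_pos_left hn']

theorem crossLink_nsmul {n : ℕ} (hn : 0 < n) (e : Pt) : crossLink (n • e) = crossLink e := by
  funext j
  simp only [crossLink, cross_nsmul hn]

theorem exists_eq_smul_of_det_eq_zero (he : IsCoprime e.1 e.2) {v : Pt} (hv : det e v = 0) :
    ∃ t : ℤ, v = t • e := by
  obtain ⟨x, y, hxy⟩ := he
  unfold det at hv
  refine ⟨x * v.1 + y * v.2, Prod.ext ?_ ?_⟩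
  · simp only [Prod.smul_fst, smul_eq_mul]
    linear_combination -v.1 * hxy - y * hv
  · simp only [Prod.smul_snd, smul_eq_mul]
    linear_combination -v.2 * hxy + x * hv

variable (hP : 0 < e.1) (hQ : 0 ≤ e.2)
include hP hQ

theorem cross_spec (j : ℤ) : LineCrosses e (cross e j) ∧ level (cross e j) = j :=
  Classical.epsilon_spec (exists_lineCrosses_level_eq hP hQ j)

theorem LineCrosses.cross_eq (hc : LineCrosses e c) (h : level c = j) : cross e j = c :=
  (cross_spec hP hQ j).1.eq_of_level_eq hP hQ hc ((cross_spec hP hQ j).2.trans h.symm)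

theorem cross_right_eq_iff (hb : det e b = 0) :
    (cross e j).2 = b ↔ detourStart e b ≤ j ∧ j ≤ 2 * (b.1 + b.2) + 1 := by
  rw [(cross_spec hP hQ j).1.right_eq_iff hP hQ hb, (cross_spec hP hQ j).2]

theorem crossNear_eq_true (hb : det e b = 0) (hj : detourStart e b ≤ j)
    (hj' : j ≤ 2 * (b.1 + b.2) + 1) : crossNear e j = true := by
  have hright := (cross_right_eq_iff hP hQ hb).2 ⟨hj, hj'⟩
  have hleft := (cross_spec hP hQ j).1.left_pos
  rw [crossNear, decide_eq_true_iff, det_add, hright, hb, add_zero]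
  exact hleft

theorem crossLink_eq_true (hb : det e b = 0) (hj : detourStart e b ≤ j)
    (hj' : j ≤ 2 * (b.1 + b.2)) : crossLink e j = true := by
  rw [crossLink, decide_eq_true_iff, (cross_right_eq_iff hP hQ hb).2 ⟨hj, by omega⟩,
    (cross_right_eq_iff hP hQ hb).2 ⟨by omega, by omega⟩]

theorem crossLink_detourEnd (hb : det e b = 0) :
    crossLink e (2 * (b.1 + b.2) + 1) = false := by
  have hstart : detourStart e b ≤ 2 * (b.1 + b.2) + 1 := by unfold detourStart; split_ifs <;> omega
  rw [crossLink, decide_eq_false_iff_not, (cross_right_eq_iff hP hQ hb).2 ⟨hstart, le_rfl⟩,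
    eq_comm, cross_right_eq_iff hP hQ hb]
  omega

theorem crossLink_detourStart_sub_one (hb : det e b = 0) :
    crossLink e (detourStart e b - 1) = false := by
  have hstart : detourStart e b ≤ 2 * (b.1 + b.2) + 1 := by unfold detourStart; split_ifs <;> omega
  rw [crossLink, decide_eq_false_iff_not, sub_add_cancel,
    (cross_right_eq_iff hP hQ hb).2 ⟨le_rfl, hstart⟩, cross_right_eq_iff hP hQ hb]
  omega

theorem crossLink_eq_false_iff :
    crossLink e j = false ↔ (cross e j).1 = (cross e (j + 1)).1 := by
  have hlevel : level (cross e (j + 1)) = level (cross e j) + 1 := by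
    rw [(cross_spec hP hQ j).2, (cross_spec hP hQ (j + 1)).2]
  rw [crossLink, decide_eq_false_iff_not, (cross_spec hP hQ j).1.left_eq_iff_right_ne hP hQ
    (cross_spec hP hQ (j + 1)).1 hlevel]

section Period

theorem cross_add_period (j : ℤ) : cross e (j + 2 * (e.1 + e.2)) = cross e j + (e, e) := by
  obtain ⟨⟨hseg, hleft, hright⟩, hlevel⟩ := cross_spec hP hQ j
  refine LineCrosses.cross_eq hP hQ ⟨?_, ?_, ?_⟩ ?_
  · simpa [IsSegment] using hseg
  · simpa [det_add, det_self] using hleft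
  · simpa [det_add, det_self] using hright
  · simp only [level, Prod.fst_add, Prod.snd_add] at hlevel ⊢
    linarith

theorem periodic_crossNear : Function.Periodic (crossNear e) (2 * (e.1 + e.2)) := by
  intro j
  simp only [crossNear, cross_add_period hP hQ, Prod.fst_add, Prod.snd_add, det_add, det_self,
    add_zero]

theorem periodic_crossLink : Function.Periodic (crossLink e) (2 * (e.1 + e.2)) := by
  intro j
  simp only [crossLink, add_right_comm j _ 1, cross_add_period hP hQ, Prod.snd_add, add_left_inj]

end Period

section Reflection

variable (he : IsCoprime e.1 e.2) (hj : 2 ≤ j) (hj' : j ≤ 2 * (e.1 + e.2) - 2)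
include he hj hj'

theorem det_cross_right_neg : det e (cross e j).2 < 0 := by
  refine (cross_spec hP hQ j).1.right_nonpos.lt_of_ne fun hb => ?_
  obtain ⟨t, ht⟩ := exists_eq_smul_of_det_eq_zero he hb
  obtain ⟨hge, hle⟩ := (cross_right_eq_iff hP hQ hb).1 rfl
  rw [detourStart, ht] at hge
  rw [ht] at hle
  simp only [Prod.smul_fst, Prod.smul_snd, smul_eq_mul, ← mul_add] at hge hle
  have : 0 < t := by
    by_contra! hnonpos
    nlinarith
  have : t < 1 := by
    by_contra! hone
    split_ifs at hge <;> nlinarith [hone]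
  omega

theorem cross_reflect :
    cross e (2 * (e.1 + e.2) - j) = (e - (cross e j).2, e - (cross e j).1) := by
  obtain ⟨⟨hseg, hleft, -⟩, hlevel⟩ := cross_spec hP hQ j
  refine LineCrosses.cross_eq hP hQ ⟨?_, ?_, ?_⟩ ?_
  · simpa [IsSegment] using hseg
  · simpa [det_sub, det_self] using det_cross_right_neg hP hQ he hj hj'
  · simpa [det_sub, det_self] using hleft.le
  · simp only [level, Prod.fst_sub, Prod.snd_sub] at hlevel ⊢
    linarith

theorem crossNear_reflect (hne : j ≠ e.1 + e.2) :
    crossNear e (2 * (e.1 + e.2) - j) = !crossNear e j := by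
  have hmid : det e ((cross e j).1 + (cross e j).2) ≠ 0 := by
    intro h
    obtain ⟨t, ht⟩ := exists_eq_smul_of_det_eq_zero he h
    have hlevel : j = t * (e.1 + e.2) := by
      rw [← (cross_spec hP hQ j).2]
      have h1 := congrArg Prod.fst ht
      have h2 := congrArg Prod.snd ht
      simp only [Prod.fst_add, Prod.snd_add, Prod.smul_fst, Prod.smul_snd, smul_eq_mul] at h1 h2
      rw [level]
      linarith
    have : 0 < t := by
      by_contra! hnonpos
      nlinarith
    have : t < 2 := by
      by_contra! htwo
      nlinarith
    obtain rfl : t = 1 := by omega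
    omega
  rw [crossNear, crossNear, cross_reflect hP hQ he hj hj', ← decide_not, decide_eq_decide]
  simp only [det_add, det_sub, det_self] at hmid ⊢
  omega

end Reflection

theorem crossLink_reflect (he : IsCoprime e.1 e.2) (hj : 2 ≤ j) (hj' : j ≤ 2 * (e.1 + e.2) - 3) :
    crossLink e (2 * (e.1 + e.2) - 1 - j) = !crossLink e j := by
  have hnext := cross_reflect hP hQ he (j := j + 1) (by omega) (by omega)
  have hsub : 2 * (e.1 + e.2) - 1 - j + 1 = 2 * (e.1 + e.2) - j := by ring
  rw [← sub_sub, sub_right_comm] at hnext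
  rw [← Bool.not_eq_eq_eq_not, Bool.eq_iff_iff, Bool.not_eq_true', crossLink_eq_false_iff hP hQ,
    hsub, hnext, cross_reflect hP hQ he hj (by omega), sub_right_inj, eq_comm, crossLink,
    decide_eq_true_iff]

theorem crossNear_center (he : IsCoprime e.1 e.2) (hl : 2 ≤ e.1 + e.2) :
    crossNear e (e.1 + e.2) = false := by
  have h := congrArg Prod.fst (cross_reflect hP hQ he hl (by omega))
  rw [two_mul, add_sub_cancel_right, eq_sub_iff_add_eq] at h
  rw [crossNear, h, det_self, decide_eq_false_iff_not]
  exact lt_irrefl 0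

end Cross

section Enumeration

namespace Crossing

theorem lineCrosses {e : Pt} (c : Crossing e) : LineCrosses e (c.left, c.right) :=
  ⟨c.isSegment, c.left_pos, c.right_nonpos⟩

theorem ext_endpoints {d : Pt} {c c' : Crossing d} (h : (c.left, c.right) = (c'.left, c'.right)) :
    c = c' := by
  cases c
  cases c'
  cases h
  rfl

theorem Before.asymm {d : Pt} {c c' : Crossing d} (h : c.Before c') : ¬ c'.Before c := by
  have hdet (u v : Pt) : det u v = -det v u := by simp only [det]; ring
  rintro (h' | ⟨h', g'⟩) <;> rcases h with h | ⟨h, g⟩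
  · exact lt_asymm h h'
  · exact h'.ne h.symm
  · exact h.ne h'.symm
  · rw [hdet] at g
    omega

end Crossing

variable {e : Pt} (hP : 0 < e.1) (hQ : 0 ≤ e.2)
include hP hQ

theorem Crossing.before_of_level_lt {c c' : Crossing e}
    (h : level (c.left, c.right) < level (c'.left, c'.right)) : c.Before c' := by
  have hl : ((e.1 + e.2 : ℤ) : ℚ) ≠ 0 := by exact_mod_cast (by omega : e.1 + e.2 ≠ 0)
  by_cases hb : c.right = c'.right ∧ det e c.right = 0
  · obtain ⟨hright, h0⟩ := hb
    have ht := c.lineCrosses.mul_time_eq h0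
    have ht' := c'.lineCrosses.mul_time_eq (by rw [← h0, hright])
    have heq : time e c.left c.right = time e c'.left c'.right :=
      mul_left_cancel₀ hl (ht.trans (by rw [ht', hright]))
    exact Or.inr ⟨heq, c.lineCrosses.det_sub_pos_of_right_eq hP hQ c'.lineCrosses h hright⟩
  · have hlt := c.lineCrosses.time_lt_time hP hQ c'.lineCrosses h fun hr h0 => hb ⟨hr, h0⟩
    exact Or.inl hlt

theorem Crossing.before_iff_level_lt {c c' : Crossing e} :
    c.Before c' ↔ level (c.left, c.right) < level (c'.left, c'.right) := by
  refine ⟨fun h => ?_, before_of_level_lt hP hQ⟩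
  by_contra! hle
  rcases hle.lt_or_eq with hlt | heq
  · exact h.asymm (before_of_level_lt hP hQ hlt)
  · obtain rfl := ext_endpoints (c'.lineCrosses.eq_of_level_eq hP hQ c.lineCrosses heq)
    exact h.asymm h

theorem exists_isFenceCode : ∃ f : Fin (detourStart e e - 2).toNat ≃ Crossing e,
    IsFenceCode f (fun i => crossNear e (2 + i)) (fun i => crossLink e (2 + i)) := by
  have hspec := cross_spec hP hQ
  let g (i : Fin (detourStart e e - 2).toNat) : Crossing e :=
    { left := (cross e (2 + i)).1
      right := (cross e (2 + i)).2
      isSegment := (hspec _).1.isSegment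
      left_pos := (hspec _).1.left_pos
      right_nonpos := (hspec _).1.right_nonpos
      time_pos := ((hspec _).1.time_pos_iff hP hQ).2 (by rw [(hspec _).2]; omega)
      time_lt_one := ((hspec _).1.time_lt_one_iff hP hQ).2 (by rw [(hspec _).2]; omega) }
  have hlevel (i) : level ((g i).left, (g i).right) = 2 + i := (hspec _).2
  have hg : Function.Bijective g := by
    refine ⟨fun i i' h => Fin.ext ?_, fun c => ?_⟩
    · have := hlevel i
      rw [h, hlevel] at this
      omega
    · have hge := (c.lineCrosses.time_pos_iff hP hQ).1 c.time_pos
      have hlt := (c.lineCrosses.time_lt_one_iff hP hQ).1 c.time_lt_one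
      refine ⟨⟨(level (c.left, c.right) - 2).toNat, by omega⟩, Crossing.ext_endpoints ?_⟩
      exact c.lineCrosses.cross_eq hP hQ (by push_cast; omega)
  refine ⟨Equiv.ofBijective g hg, fun i i' => ?_, fun i => ?_, fun i i' h => ?_, fun i i' h => ?_⟩
  · rw [Equiv.ofBijective_apply, Equiv.ofBijective_apply, Crossing.before_iff_level_lt hP hQ,
      hlevel, hlevel]
    omega
  · exact (hspec _).1.half_lt_fraction_iff.trans decide_eq_true_iff.symm
  · have hnext : (2 + i' : ℤ) = 2 + i + 1 := by omega
    simp [g, crossLink, hnext]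
  · have hnext : (2 + i' : ℤ) = 2 + i + 1 := by omega
    rw [crossLink_eq_false_iff hP hQ, ← hnext]
    rfl

end Enumeration

section Rotation

/-- The orientation-preserving symmetries of the lattice `𝓛` that fix the origin: additive
automorphisms of the integral points that preserve the determinant and the segments. -/
structure IsLatticeRotation (ρ : Pt ≃+ Pt) : Prop where
  det_map : ∀ u v, det (ρ u) (ρ v) = det u v
  isSegment_map : ∀ a b, IsSegment (ρ a) (ρ b) ↔ IsSegment a b

/-- The generator of the group of lattice rotations, which is cyclic of order six: it permutes the
six directions of segments cyclically. -/
def sixthTurn : Pt ≃+ Pt where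
  toFun v := (-v.2, v.1 + v.2)
  invFun v := (v.1 + v.2, -v.1)
  left_inv v := by ext <;> simp
  right_inv v := by ext <;> simp
  map_add' u v := by ext <;> simp <;> ring

theorem isLatticeRotation_refl : IsLatticeRotation (AddEquiv.refl Pt) :=
  ⟨fun _ _ => rfl, fun _ _ => Iff.rfl⟩

theorem isLatticeRotation_sixthTurn : IsLatticeRotation sixthTurn := by
  constructor
  · intro u v
    simp only [det, sixthTurn, AddEquiv.coe_mk, Equiv.coe_fn_mk]
    ring
  · intro a b
    simp only [IsSegment, sixthTurn, AddEquiv.coe_mk, Equiv.coe_fn_mk, Prod.ext_iff, Prod.fst_sub,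
      Prod.snd_sub]
    omega

theorem IsLatticeRotation.trans {ρ ρ' : Pt ≃+ Pt} (h : IsLatticeRotation ρ)
    (h' : IsLatticeRotation ρ') : IsLatticeRotation (ρ.trans ρ') :=
  ⟨fun u v => (h'.det_map _ _).trans (h.det_map u v),
    fun a b => (h'.isSegment_map _ _).trans (h.isSegment_map a b)⟩

theorem exists_isLatticeRotation {d : Pt} (hd : d ≠ 0) :
    ∃ ρ e, IsLatticeRotation ρ ∧ ρ e = d ∧ 0 < e.1 ∧ 0 ≤ e.2 := by
  have r1 := isLatticeRotation_sixthTurn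
  have r2 := r1.trans r1
  have r3 := r2.trans r1
  have r4 := r3.trans r1
  have r5 := r4.trans r1
  obtain ⟨p, q⟩ := d
  have hpq : p ≠ 0 ∨ q ≠ 0 := by
    by_contra! h
    exact hd (Prod.ext h.1 h.2)
  obtain h | h | h | h | h | h : (0 < p ∧ 0 ≤ q) ∨ (0 < p + q ∧ 0 ≤ -p) ∨
      (0 < q ∧ 0 ≤ -(p + q)) ∨ (0 < -p ∧ 0 ≤ -q) ∨ (0 < -(p + q) ∧ 0 ≤ p) ∨
      (0 < -q ∧ 0 ≤ p + q) := by omega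
  · exact ⟨_, (p, q), isLatticeRotation_refl, rfl, h⟩
  · exact ⟨_, (p + q, -p), r1, by simp [sixthTurn], h⟩
  · exact ⟨_, (q, -(p + q)), r2, by simp [sixthTurn], h⟩
  · exact ⟨_, (-p, -q), r3, by simp [sixthTurn], h⟩
  · exact ⟨_, (-(p + q), p), r4, by simp [sixthTurn], h⟩
  · exact ⟨_, (-q, p + q), r5, by simp [sixthTurn], h⟩

namespace IsLatticeRotation

variable {ρ : Pt ≃+ Pt} (hρ : IsLatticeRotation ρ)
include hρ

theorem time_map (d a b : Pt) : time (ρ d) (ρ a) (ρ b) = time d a b := by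
  simp only [time, hρ.det_map]

theorem fraction_map (d a b : Pt) : fraction (ρ d) (ρ a) (ρ b) = fraction d a b := by
  simp only [fraction, hρ.det_map]

theorem isCoprime {e : Pt} (h : IsCoprime (ρ e).1 (ρ e).2) : IsCoprime e.1 e.2 := by
  obtain ⟨a, b, hab⟩ := h
  obtain ⟨u, hu⟩ := ρ.surjective (b, -a)
  have hdet := hρ.det_map u e
  rw [hu] at hdet
  simp only [det] at hdet
  exact ⟨-u.2, u.1, by linarith⟩

theorem exists_isFenceCode_map {e : Pt} {N : ℕ} {f : Fin N ≃ Crossing e} {near link : ℕ → Bool}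
    (hf : IsFenceCode f near link) :
    ∃ f' : Fin N ≃ Crossing (ρ e), IsFenceCode f' near link := by
  let g (c : Crossing e) : Crossing (ρ e) :=
    { left := ρ c.left
      right := ρ c.right
      isSegment := (hρ.isSegment_map _ _).2 c.isSegment
      left_pos := (hρ.det_map _ _).symm ▸ c.left_pos
      right_nonpos := (hρ.det_map _ _).symm ▸ c.right_nonpos
      time_pos := (hρ.time_map _ _ _).symm ▸ c.time_pos
      time_lt_one := (hρ.time_map _ _ _).symm ▸ c.time_lt_one }
  have hg : Function.Bijective g := by
    refine ⟨fun c c' h => ?_, ?_⟩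
    · injection h with hl hr
      exact Crossing.ext_endpoints (Prod.ext (ρ.injective hl) (ρ.injective hr))
    · rintro ⟨a', b', hseg, hleft, hright, h0, h1⟩
      obtain ⟨⟨a, rfl⟩, ⟨b, rfl⟩⟩ := ρ.surjective a', ρ.surjective b'
      rw [hρ.isSegment_map] at hseg
      rw [hρ.det_map] at hleft hright
      rw [hρ.time_map] at h0 h1
      exact ⟨⟨a, b, hseg, hleft, hright, h0, h1⟩, rfl⟩
  refine ⟨f.trans (Equiv.ofBijective g hg), fun i j => ?_, fun i => ?_, fun i j h => ?_,
    fun i j h => ?_⟩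
  · rw [← hf.before_iff]
    simp [g, Crossing.Before, hρ.time_map, ← map_sub, hρ.det_map]
  · rw [← hf.nearRight_iff]
    simp [g, Crossing.NearRight, hρ.fraction_map]
  · rw [← hf.right_eq_iff i j h]
    exact ρ.injective.eq_iff
  · rw [← hf.left_eq_iff i j h]
    exact ρ.injective.eq_iff

end IsLatticeRotation

theorem finite_crossing {d : Pt} (hd : d ≠ 0) : Finite (Crossing d) := by
  obtain ⟨ρ, e, hρ, rfl, hP, hQ⟩ := exists_isLatticeRotation hd
  obtain ⟨f, hf⟩ := exists_isFenceCode hP hQ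
  obtain ⟨f', -⟩ := hρ.exists_isFenceCode_map hf
  exact Finite.of_equiv _ f'

end Rotation

section PeriodMatrix

/-- The transfer matrix of the crossing of the line `ℝ e` with the given level, together with the
relation to the next crossing. -/
noncomputable def crossMatrix (k : ℕ) (e : Pt) (j : ℤ) : Matrix (Fin 2) (Fin 2) ℤ :=
  blockMatrix k (crossNear e j) (crossLink e j)

/-- The transfer matrix of a period of the line `ℝ e`, beginning with the first crossing of the
segment from `0` to `e` and ending with the detour around `e`. -/
noncomputable def periodMatrix (k : ℕ) (e : Pt) : Matrix (Fin 2) (Fin 2) ℤ :=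
  orderedProd (crossMatrix k e) 2 (2 * (e.1 + e.2).toNat)

theorem det_periodMatrix (k : ℕ) (e : Pt) : (periodMatrix k e).det = 1 :=
  det_orderedProd (fun _ => det_blockMatrix k _ _) _ _

theorem stepMatrix_true_pow_mul_stepMatrix_false_mulVec (n : ℕ) :
    (stepMatrix true ^ n * stepMatrix false) *ᵥ ![1, -1] = ![1, 0] := by
  rw [stepMatrix_true_pow]
  ext i
  fin_cases i <;> simp [stepMatrix]

variable {e b : Pt}

section Sector

variable (hP : 0 < e.1) (hQ : 0 ≤ e.2)
include hP hQ

theorem orderedProd_crossMatrix_detour (k : ℕ) (hb : det e b = 0) (n : ℕ)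
    (hn : detourStart e b ≤ 2 * (b.1 + b.2) + 1 - n) :
    orderedProd (crossMatrix k e) (2 * (b.1 + b.2) + 1 - n) (n + 1) =
      stepMatrix true ^ (n * (k + 1) + k) * stepMatrix false := by
  have hnear := crossNear_eq_true hP hQ hb hn (by omega)
  induction n with
  | zero =>
    rw [Nat.cast_zero, sub_zero] at hnear ⊢
    rw [orderedProd_succ, orderedProd_zero, one_mul, Nat.cast_zero, add_zero, crossMatrix, hnear,
      crossLink_detourEnd hP hQ hb, blockMatrix, zero_mul, zero_add]
  | succ n ih =>
    have hnext : 2 * (b.1 + b.2) + 1 - ((n + 1 : ℕ) : ℤ) + 1 = 2 * (b.1 + b.2) + 1 - n := by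
      push_cast
      ring
    have hle : detourStart e b ≤ 2 * (b.1 + b.2) + 1 - n := by omega
    rw [orderedProd_succ', hnext, ih hle (crossNear_eq_true hP hQ hb hle (by omega)), crossMatrix,
      hnear, crossLink_eq_true hP hQ hb hn (by omega), blockMatrix, ← pow_succ, ← mul_assoc,
      ← pow_add]
    congr 2
    ring

theorem orderedProd_crossMatrix_mulVec (k : ℕ) :
    orderedProd (crossMatrix k e) 2 (detourStart e e - 2).toNat *ᵥ ![1, 0] =
      periodMatrix k e *ᵥ ![1, -1] := by
  obtain ⟨n, hn⟩ : ∃ n : ℕ, detourStart e e = 2 * (e.1 + e.2) + 1 - n := by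
    refine ⟨(2 * (e.1 + e.2) + 1 - detourStart e e).toNat, ?_⟩
    unfold detourStart
    split_ifs <;> omega
  have hge : 2 ≤ detourStart e e := by unfold detourStart; split_ifs <;> omega
  have hlen : 2 * (e.1 + e.2).toNat = (detourStart e e - 2).toNat + (n + 1) := by omega
  have hstart : 2 + ((detourStart e e - 2).toNat : ℤ) = 2 * (e.1 + e.2) + 1 - n := by omega
  rw [periodMatrix, hlen, orderedProd_add, hstart,
    orderedProd_crossMatrix_detour hP hQ k (det_self e) n hn.le, ← mulVec_mulVec,
    stepMatrix_true_pow_mul_stepMatrix_false_mulVec]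

theorem ncard_orderIdeals_rotation (k : ℕ) {ρ : Pt ≃+ Pt} (hρ : IsLatticeRotation ρ) :
    ((orderIdeals k (ρ e)).ncard : ℤ) = 1 ⬝ᵥ periodMatrix k e *ᵥ ![1, -1] := by
  obtain ⟨f, hf⟩ := exists_isFenceCode hP hQ
  obtain ⟨f', hf'⟩ := hρ.exists_isFenceCode_map hf
  have hend (j : ℕ) (hj : j + 1 = (detourStart e e - 2).toNat) : crossLink e (2 + j) = false := by
    rw [← crossLink_detourStart_sub_one hP hQ (det_self e)]
    congr 1
    omega
  rw [hf'.ncard_orderIdeals hend, ← orderedProd_crossMatrix_mulVec hP hQ k, dotProduct_mulVec]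
  simp [orderedProd, crossMatrix, dotProduct]

theorem periodMatrix_nsmul (k : ℕ) {n : ℕ} (hn : 0 < n) :
    periodMatrix k (n • e) = periodMatrix k e ^ n := by
  have hperiod : Function.Periodic (crossMatrix k e) ((2 * (e.1 + e.2).toNat : ℕ) : ℤ) := by
    have hcast : ((2 * (e.1 + e.2).toNat : ℕ) : ℤ) = 2 * (e.1 + e.2) := by omega
    intro j
    rw [hcast, crossMatrix, periodic_crossNear hP hQ, periodic_crossLink hP hQ, crossMatrix]
  have hlen : 2 * ((n • e).1 + (n • e).2).toNat = n * (2 * (e.1 + e.2).toNat) := by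
    obtain ⟨l, hl⟩ := Int.eq_ofNat_of_zero_le (by omega : 0 ≤ e.1 + e.2)
    rw [Prod.smul_fst, Prod.smul_snd, ← smul_add, hl, nsmul_eq_mul, ← Nat.cast_mul,
      Int.toNat_natCast, Int.toNat_natCast, mul_left_comm]
  have hmatrix : crossMatrix k (n • e) = crossMatrix k e := by
    funext j
    rw [crossMatrix, crossNear_nsmul hn, crossLink_nsmul hn, crossMatrix]
  rw [periodMatrix, hmatrix, hlen, orderedProd_mul_of_periodic hperiod, periodMatrix]

-- The central symmetry of the segment from `0` to `e` reverses the first half of the crossings and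
-- transposes their transfer matrices; the crossing of level `e.1 + e.2` is its own mirror image.
theorem orderedProd_crossMatrix_center (k : ℕ) (he : IsCoprime e.1 e.2) {n : ℕ}
    (hn : e.1 + e.2 = n + 2) :
    orderedProd (crossMatrix k e) (2 + n) (n + 1) =
      stepMatrix false ^ k * (orderedProd (crossMatrix k e) 2 n)ᵀ *
        stepMatrix (crossLink e (2 + n + n)) := by
  have hcenter : crossNear e (2 + n) = false := by
    rw [← crossNear_center hP hQ he (by omega), hn, add_comm]
  have hfold := orderedProd_mul_eq_of_reflection (fun j => stepMatrix (crossNear e j) ^ k)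
    (fun j => stepMatrix (crossLink e j)) (2 + n) n (fun i hi => ?_) (fun i hi => ?_)
  · rwa [hcenter, add_sub_cancel_right] at hfold
  · have hreflect := crossNear_reflect hP hQ he (j := 2 + n - 1 - i) (by omega) (by omega)
      (by omega)
    rw [hn, show (2 * (n + 2) - (2 + n - 1 - i) : ℤ) = 2 + n + 1 + i by ring] at hreflect
    rw [transpose_pow, transpose_stepMatrix, hreflect]
  · have hreflect := crossLink_reflect hP hQ he (j := 2 + n - 1 - i) (by omega) (by omega)
    rw [hn, show (2 * (n + 2) - 1 - (2 + n - 1 - i) : ℤ) = 2 + n + i by ring] at hreflect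
    rw [transpose_stepMatrix, hreflect]

end Sector

theorem periodMatrix_one_zero (k : ℕ) :
    periodMatrix k (1, 0) = stepMatrix true ^ (2 * k + 1) * stepMatrix false := by
  have hdetour := orderedProd_crossMatrix_detour one_pos le_rfl k (det_self (1, 0)) 1
    (by simp [detourStart])
  rwa [show 1 * (k + 1) + k = 2 * k + 1 by ring] at hdetour

theorem periodMatrix_eq_mul_detourMatrix (hP : 0 < e.1) (hQ : 0 < e.2) (he : IsCoprime e.1 e.2)
    (k : ℕ) {n : ℕ} (hn : e.1 + e.2 = n + 2) :
    periodMatrix k e = orderedProd (crossMatrix k e) 2 n * stepMatrix false ^ k *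
      (orderedProd (crossMatrix k e) 2 n)ᵀ * detourMatrix k := by
  have hstart : detourStart e e = 2 * (e.1 + e.2) + 1 - (2 : ℕ) := by
    rw [detourStart, if_pos hQ]
    push_cast
    ring
  have hlink : crossLink e (2 + n + n) = false := by
    rw [← crossLink_detourStart_sub_one hP hQ.le (det_self e), hstart, hn]
    push_cast
    congr 1
    ring
  have hdetour := orderedProd_crossMatrix_detour hP hQ.le k (det_self e) 2 hstart.le
  have hlen : 2 * (e.1 + e.2).toNat = n + (n + 1 + (2 + 1)) := by omega
  have hend : 2 + n + ((n + 1 : ℕ) : ℤ) = 2 * (e.1 + e.2) + 1 - (2 : ℕ) := by omega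
  rw [periodMatrix, hlen, orderedProd_add, orderedProd_add,
    orderedProd_crossMatrix_center hP hQ.le k he hn, hlink, hend, hdetour, detourMatrix,
    show 2 * (k + 1) + k = 3 * k + 2 by ring]
  simp only [mul_assoc]

theorem trace_periodMatrix (hP : 0 < e.1) (hQ : 0 ≤ e.2) (he : IsCoprime e.1 e.2) (k : ℕ) :
    (periodMatrix k e).trace =
      (3 + 3 * k) * (1 ⬝ᵥ periodMatrix k e *ᵥ ![1, -1]) - k := by
  rcases hQ.eq_or_lt with hQ' | hQ'
  · obtain rfl : e = (1, 0) := by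
      rw [← hQ', isCoprime_zero_right, Int.isUnit_iff] at he
      exact Prod.ext (by omega) hQ'.symm
    rw [periodMatrix_one_zero, stepMatrix_true_pow_mul_stepMatrix_false_mulVec,
      stepMatrix_true_pow, trace_fin_two]
    simp only [stepMatrix, mul_fin_two, dotProduct, Fin.sum_univ_two, of_apply, cons_val,
      Pi.one_apply]
    push_cast
    ring
  · obtain ⟨n, hn⟩ : ∃ n : ℕ, e.1 + e.2 = n + 2 := ⟨(e.1 + e.2 - 2).toNat, by omega⟩
    rw [periodMatrix_eq_mul_detourMatrix hP hQ' he k hn]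
    exact trace_mul_detourMatrix k <| mul_stepMatrix_pow_mul_transpose_sub k <|
      det_orderedProd (fun j => det_blockMatrix k (crossNear e j) (crossLink e j)) _ _

end PeriodMatrix

section Recurrence

variable {p q : ℤ}

theorem m_eq_ncard (k : ℕ) (hpq : ((p, q) : Pt) ≠ 0) : m k p q = (orderIdeals k (p, q)).ncard :=
  if_neg fun ⟨hp, hq⟩ => hpq (Prod.ext hp hq)

theorem pt_ne_zero_of_isCoprime (hpq : IsCoprime p q) : ((p, q) : Pt) ≠ 0 := by
  intro h
  obtain ⟨rfl, rfl⟩ := Prod.mk.inj h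
  exact not_isCoprime_zero_zero hpq

theorem m_pos (k : ℕ) (hpq : ((p, q) : Pt) ≠ 0) : 0 < m k p q := by
  have := finite_crossing hpq
  rw [m_eq_ncard k hpq, Set.ncard_pos]
  exact ⟨∅, fun _ hx => hx.elim⟩

theorem exists_periodMatrix (k : ℕ) (hpq : IsCoprime p q) :
    ∃ X : Matrix (Fin 2) (Fin 2) ℤ, X.det = 1 ∧ X.trace = (3 + 3 * k) * m k p q - k ∧
      ∀ n : ℕ, (m k (n * p) (n * q) : ℤ) = 1 ⬝ᵥ X ^ n *ᵥ ![1, -1] := by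
  have hd := pt_ne_zero_of_isCoprime hpq
  obtain ⟨ρ, e, hρ, hρe, hP, hQ⟩ := exists_isLatticeRotation hd
  have he : IsCoprime e.1 e.2 := hρ.isCoprime (by rwa [hρe])
  have hm (n : ℕ) : (m k (n * p) (n * q) : ℤ) = 1 ⬝ᵥ periodMatrix k e ^ n *ᵥ ![1, -1] := by
    rcases n.eq_zero_or_pos with rfl | hn
    · simp [m, dotProduct]
    · have hmap : ρ (n • e) = (n * p, n * q) := by
        rw [map_nsmul, hρe]
        simp
      have hne : ((n * p, n * q) : Pt) ≠ 0 := by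
        simpa [hn.ne'] using hd
      rw [m_eq_ncard k hne, ← hmap, ncard_orderIdeals_rotation ?_ ?_ k hρ,
        periodMatrix_nsmul hP hQ k hn]
      · exact nsmul_pos hP hn.ne'
      · exact nsmul_nonneg hQ n
  refine ⟨periodMatrix k e, det_periodMatrix k e, ?_, hm⟩
  have h1 := hm 1
  rw [Nat.cast_one, one_mul, one_mul, pow_one] at h1
  rw [trace_periodMatrix hP hQ he k, h1]

end Recurrence

end KMarkov

theorem proposition3 (k : ℕ) (p q : ℤ) (hpq : IsCoprime p q)
    (η : ℝ) (hη : η = (3 + 3 * (k : ℝ)) * (KMarkov.m k p q : ℝ) - (k : ℝ)) :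
    (KMarkov.m k (((0 : ℕ) : ℤ) * p) (((0 : ℕ) : ℤ) * q) = 0 ∧
      KMarkov.m k (((1 : ℕ) : ℤ) * p) (((1 : ℕ) : ℤ) * q) = KMarkov.m k p q ∧
      ∀ n : ℕ,
        (KMarkov.m k (((n + 2 : ℕ) : ℤ) * p) (((n + 2 : ℕ) : ℤ) * q) : ℤ) =
          ((3 + 3 * (k : ℤ)) * (KMarkov.m k p q : ℤ) - (k : ℤ)) *
              (KMarkov.m k (((n + 1 : ℕ) : ℤ) * p) (((n + 1 : ℕ) : ℤ) * q) : ℤ) -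
            (KMarkov.m k ((n : ℤ) * p) ((n : ℤ) * q) : ℤ)) ∧
    (2 < η ∧
      ∀ n : ℕ,
        (KMarkov.m k ((n : ℤ) * p) ((n : ℤ) * q) : ℝ) =
          (KMarkov.m k p q : ℝ) / √(η ^ 2 - 4) * ((η + √(η ^ 2 - 4)) / 2) ^ n -
            (KMarkov.m k p q : ℝ) / √(η ^ 2 - 4) * ((η - √(η ^ 2 - 4)) / 2) ^ n) := by
  obtain ⟨X, hdet, htrace, hm⟩ := KMarkov.exists_periodMatrix k hpq
  have h0 : KMarkov.m k (((0 : ℕ) : ℤ) * p) (((0 : ℕ) : ℤ) * q) = 0 := by simp [KMarkov.m]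
  have h1 : KMarkov.m k (((1 : ℕ) : ℤ) * p) (((1 : ℕ) : ℤ) * q) = KMarkov.m k p q := by
    rw [Nat.cast_one, one_mul, one_mul]
  have hrec := KMarkov.dotProduct_pow_add_two_mulVec hdet 1 ![1, -1]
  simp only [← hm, htrace] at hrec
  have hpos : (1 : ℝ) ≤ KMarkov.m k p q := by
    exact_mod_cast KMarkov.m_pos k (KMarkov.pt_ne_zero_of_isCoprime hpq)
  have hη2 : 2 < η := by
    rw [hη]
    nlinarith [(k.cast_nonneg : (0 : ℝ) ≤ k)]
  refine ⟨⟨h0, h1, hrec⟩, hη2, fun n => ?_⟩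
  have hclosed := KMarkov.closed_form (fun n : ℕ => (KMarkov.m k (n * p) (n * q) : ℝ)) η hη2
    (by exact_mod_cast h0) (fun n => by rw [hη]; exact_mod_cast hrec n) n
  simpa only [h1] using hclosed
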